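/- Let $R$ be a commutative artinian ring, $A$ an artin $R$-algebra (an $R$-algebra that is finitely generated as an $R$-module), and $A$-mod the category of finitely generated left $A$-modules. Let $F$ be an additive subbifunctor of $\mathrm{Ext}^1_A(-,-)$ on $A$-mod. A short exact sequence $0\to X\to Y\to Z\to 0$ in $A$-mod is $F$-exact if its class lies in $F(Z,X)$, and $P$ is $F$-projective if $\mathrm{Hom}_A(P,-)$ is exact on $F$-exact sequences. Assume that $F$ has enough projectives: every $M\in A$-mod admits an $F$-exact sequence $0\to L\to P\to M\to 0$ with $P$ $F$-projective; any such $L$ is called a relative syzygy of $M$ and written $\Omega_F(M)$. Write $\mathrm{Ext}^1_F(M,-)=F(M,-)$, and, for $n\ge 0$, let $\mathrm{Ext}^{n+1}_F(M,-)$ be the $(n+1)$-st cohomology of $\mathrm{Hom}_A(P_\bullet,-)$, where $P_\bullet\to M$ is an $F$-projective resolution (an $F$-acyclic augmented complex in $A$-mod with $F$-projective terms $P_i$). These are functors from $A$-mod to abelian groups. Let $K_F(A)$ be the abelian group generated by the isomorphism classes $[M]$, $M\in A$-mod, with relations $[N]=[X]+[Y]$ whenever $N\cong X\oplus Y$, and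 $[P]=0$ for $P$ $F$-projective. Let $\mathcal E_F(A)$ be the abelian group generated by the isomorphism classes $[\mathrm{Ext}^1_F(M,-)]$ of functors, $M\in A$-mod, with relations $[\mathrm{Ext}^1_F(N,-)]=[\mathrm{Ext}^1_F(X,-)]+[\mathrm{Ext}^1_F(Y,-)]$ whenever $N\cong X\oplus Y$. Then: (a) The assignments $[M]\mapsto[\Omega_F(M)]$ and $[\mathrm{Ext}^1_F(M,-)]\mapsto[\mathrm{Ext}^1_F(\Omega_F(M),-)]$ (for any choice of relative syzygies) give well-defined group homomorphisms $\Omega_F\colon K_F(A)\to K_F(A)$ and $\Omega_F\colon\mathcal E_F(A)\to\mathcal E_F(A)$, the assignment $[M]\mapsto[\mathrm{Ext}^1_F(M,-)]$ gives a well-defined isomorphism of abelian groups $\varepsilon\colon K_F(A)\to\mathcal E_F(A)$, and $\varepsilon\circ\Omega_F=\Omega_F\circ\varepsilon$. (b) For every $M\in A$-mod and every $n\ge 0$, an $F$-projective resolution of $M$ exists, and, for any choice of it, the functor $\mathrm{Ext}^{n+1}_F(M,-)$ is isomorphic to $\mathrm{Ext}^1_F(N,-)$ for some $N\in A$-mod,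 and $\varepsilon(\Omega_F^n[M])=[\mathrm{Ext}^{n+1}_F(M,-)]$. -/

import Mathlib

open CategoryTheory CategoryTheory.Limits CategoryTheory.Abelian

universe u v

noncomputable section

/-- An additive subbifunctor `F` of `Ext¹_A(-,-)` on the category `A-mod` of finitely generated left
`A`-modules: a subgroup `F(M, X) ⊆ Ext¹_A(M, X)` for all finitely generated `M` and `X`, stable
under pullback along `M' ⟶ M` and pushout along `X ⟶ X'`. (The group structure on `Ext¹` is the
Baer sum. Since `Ext¹` of finitely generated modules is the same in `A-mod` and in `A-Mod`, the
groups are taken in the category of all modules.) -/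
structure ExtSubbifunctor (A : Type u) [Ring A] where
  sub (M X : FGModuleCat.{u} A) : AddSubgroup (Ext M.obj X.obj 1)
  pullback_mem : ∀ {M M' X : FGModuleCat.{u} A} (g : M' ⟶ M) (η : Ext M.obj X.obj 1),
    η ∈ sub M X → (Ext.mk₀ g.hom).comp η (zero_add 1) ∈ sub M' X
  pushout_mem : ∀ {M X X' : FGModuleCat.{u} A} (f : X ⟶ X') (η : Ext M.obj X.obj 1),
    η ∈ sub M X → η.comp (Ext.mk₀ f.hom) (add_zero 1) ∈ sub M X'

namespace ExtSubbifunctor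

variable {A : Type u} [Ring A] (F : ExtSubbifunctor A)

/-- `0 ⟶ X ⟶ Y ⟶ Z ⟶ 0` is an `F`-exact sequence of finitely generated modules: it is short exact
and its class in `Ext¹(Z, X)` lies in `F(Z, X)`. -/
def IsExact {X Y Z : FGModuleCat.{u} A} (f : X ⟶ Y) (g : Y ⟶ Z) : Prop :=
  ∃ (w : f.hom ≫ g.hom = 0) (h : (ShortComplex.mk f.hom g.hom w).ShortExact),
    h.extClass ∈ F.sub Z X

/-- `P` is `F`-projective: `Hom(P, -)` is exact on `F`-exact sequences (left exactness is
automatic). -/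
def IsProjective (P : FGModuleCat.{u} A) : Prop :=
  ∀ {X Y Z : FGModuleCat.{u} A} (f : X ⟶ Y) (g : Y ⟶ Z), F.IsExact f g →
    ∀ h : P ⟶ Z, ∃ k : P ⟶ Y, k ≫ g = h

/-- `K` is a relative syzygy of `M`: the kernel term of an `F`-exact sequence
`0 ⟶ K ⟶ P ⟶ M ⟶ 0` with `P` an `F`-projective module. (This includes the kernel of a minimal
`F`-projective cover.) -/
def IsSyzygy (M K : FGModuleCat.{u} A) : Prop :=
  ∃ (P : FGModuleCat.{u} A) (i : K ⟶ P) (p : P ⟶ M), F.IsProjective P ∧ F.IsExact i p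

/-- `F` has enough projectives. -/
def EnoughProjectives : Prop := ∀ M : FGModuleCat.{u} A, ∃ K, F.IsSyzygy M K

/-- The functor `Ext¹_F(M, -) = F(M, -)` from `A-mod` to abelian groups. -/
def extOne (M : FGModuleCat.{u} A) : FGModuleCat.{u} A ⥤ AddCommGrpCat.{u} where
  obj X := AddCommGrpCat.of (F.sub M X)
  map {X X'} f := AddCommGrpCat.ofHom
    { toFun := fun η => ⟨η.1.comp (Ext.mk₀ f.hom) (add_zero 1), F.pushout_mem f η.1 η.2⟩
      map_zero' := by ext; simp
      map_add' := fun a b => by ext; simp }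
  map_id X := by
    ext η
    change η.1.comp (Ext.mk₀ (𝟙 X.obj)) (add_zero 1) = η.1
    simp
  map_comp {X X' X''} f g := by
    ext η
    change η.1.comp (Ext.mk₀ (f.hom ≫ g.hom)) (add_zero 1) =
      (η.1.comp (Ext.mk₀ f.hom) (add_zero 1)).comp (Ext.mk₀ g.hom) (add_zero 1)
    rw [Ext.comp_assoc_of_third_deg_zero, Ext.mk₀_comp_mk₀]

/-- An `F`-projective resolution `⋯ ⟶ P₁ ⟶ P₀ ⟶ M ⟶ 0`: an `F`-acyclic augmented complex with
`F`-projective terms, presented as a splicing of `F`-exact sequences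
`0 ⟶ Zₙ₊₁ ⟶ Pₙ ⟶ Zₙ ⟶ 0` with `Z₀ ≅ M`. -/
structure ProjRes (M : FGModuleCat.{u} A) where
  P : ℕ → FGModuleCat.{u} A
  Z : ℕ → FGModuleCat.{u} A
  ι : ∀ n, Z (n + 1) ⟶ P n
  π : ∀ n, P n ⟶ Z n
  aug : Z 0 ≅ M
  isProjective : ∀ n, F.IsProjective (P n)
  isExact : ∀ n, F.IsExact (ι n) (π n)

namespace ProjRes

variable {F} {M : FGModuleCat.{u} A} (P : F.ProjRes M)

/-- The differential `Pₙ₊₁ ⟶ Pₙ`. -/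
def d (n : ℕ) : P.P (n + 1) ⟶ P.P n := P.π (n + 1) ≫ P.ι n

lemma d_comp_d (n : ℕ) : P.d (n + 1) ≫ P.d n = 0 := by
  obtain ⟨w, -⟩ := P.isExact (n + 1)
  have w' : P.ι (n + 1) ≫ P.π (n + 1) = 0 := ObjectProperty.hom_ext _ w
  simp only [d, Category.assoc]
  rw [reassoc_of% w']
  simp

/-- The sequence of functors `Hom(Pₙ, -) ⟶ Hom(Pₙ₊₁, -) ⟶ Hom(Pₙ₊₂, -)` on `A-mod`. -/
def homComplex (n : ℕ) : ShortComplex (FGModuleCat.{u} A ⥤ AddCommGrpCat.{u}) :=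
  ShortComplex.mk (preadditiveCoyoneda.map (P.d n).op) (preadditiveCoyoneda.map (P.d (n + 1)).op)
    (by rw [← Functor.map_comp, ← op_comp, d_comp_d, op_zero, Functor.map_zero])

/-- The functor `Extⁿ⁺¹_F(M, -)`: the cohomology of `Hom(P, -)` in degree `n + 1`. -/
def extSucc (n : ℕ) : FGModuleCat.{u} A ⥤ AddCommGrpCat.{u} := (P.homComplex n).homology

end ProjRes

end ExtSubbifunctor

/-- The set of isomorphism classes of objects of a category. -/
abbrev IsoClass (C : Type*) [Category C] := Quotient (isIsomorphicSetoid C)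

/-- The isomorphism class of an object. -/
abbrev isoClass {C : Type*} [Category C] (X : C) : IsoClass C :=
  Quotient.mk (isIsomorphicSetoid C) X

namespace ExtSubbifunctor

variable {A : Type u} [Ring A] (F : ExtSubbifunctor A)

/-- The relations of `K_F(A)`: `[N] - [X] - [Y]` for `N ≅ X ⊕ Y`, and `[P]` for `P` an
`F`-projective module. -/
def kRelations : Set (FreeAbelianGroup (IsoClass (FGModuleCat.{u} A))) :=
  {r | ∃ N X Y : FGModuleCat.{u} A, Nonempty (N ≃ₗ[A] X × Y) ∧
    r = .of (isoClass N) - .of (isoClass X) - .of (isoClass Y)} ∪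
  {r | ∃ P : FGModuleCat.{u} A, F.IsProjective P ∧ r = .of (isoClass P)}

/-- The group `K_F(A)`. -/
abbrev K : Type (u + 1) :=
  FreeAbelianGroup (IsoClass (FGModuleCat.{u} A)) ⧸ AddSubgroup.closure F.kRelations

/-- The class `[M]` in `K_F(A)`. -/
def kMk (M : FGModuleCat.{u} A) : F.K := QuotientAddGroup.mk (.of (isoClass M))

/-- The set of isomorphism classes of functors of the form `Ext¹_F(M, -)`. -/
def extClasses : Set (IsoClass (FGModuleCat.{u} A ⥤ AddCommGrpCat.{u})) :=
  Set.range fun M : FGModuleCat.{u} A => isoClass (F.extOne M)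

/-- The free generator attached to `Ext¹_F(M, -)`. -/
def eGen (M : FGModuleCat.{u} A) : FreeAbelianGroup F.extClasses :=
  .of ⟨isoClass (F.extOne M), M, rfl⟩

/-- The relations of `𝓔_F(A)`: `[Ext¹_F(N, -)] - [Ext¹_F(X, -)] - [Ext¹_F(Y, -)]` for
`N ≅ X ⊕ Y`. -/
def eRelations : Set (FreeAbelianGroup F.extClasses) :=
  {r | ∃ N X Y : FGModuleCat.{u} A, Nonempty (N ≃ₗ[A] X × Y) ∧
    r = F.eGen N - F.eGen X - F.eGen Y}

/-- The group `𝓔_F(A)`. -/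
abbrev E : Type (u + 1) :=
  FreeAbelianGroup F.extClasses ⧸ AddSubgroup.closure F.eRelations

/-- The class in `𝓔_F(A)` of a functor `H` that is isomorphic to some `Ext¹_F(N, -)`. -/
def eMk (H : FGModuleCat.{u} A ⥤ AddCommGrpCat.{u}) (h : isoClass H ∈ F.extClasses) : F.E :=
  QuotientAddGroup.mk (.of ⟨isoClass H, h⟩)

lemma extOne_mem (M : FGModuleCat.{u} A) : isoClass (F.extOne M) ∈ F.extClasses := ⟨M, rfl⟩

end ExtSubbifunctor

end

/-! Call `f : M ⟶ N` null if it kills `Ext¹_F(N, -)`. Null maps form an ideal, `P` is `F`-projective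
iff `𝟙 P` is null, and a null map lifts through any `F`-exact sequence ending in its target, so null
maps are those factoring through `F`-projectives. Stable isomorphism means isomorphism modulo null
maps.

Injectivity of `ε` has two ingredients. The class of a syzygy sequence of `M` generates `Ext¹_F(M,
-)`, so transformations between these functors come from homomorphisms (`exists_extPull_eq_app`) and
isomorphic functors have stably isomorphic modules. Stably isomorphic `M` and `N` satisfy `N ⊕ P ≅ M
⊕ Q` with `P`, `Q` `F`-projective (`StablyIso.kMk_eq`), so `[M] = [N]` in `K_F(A)`.

Syzygies respect stable isomorphism (`StablyIso.syzygy`) and direct sums, so `Ω_F` is defined on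
`K_F(A)`; it is transported to `𝓔_F(A)` along `ε`. Part (b) is dimension shifting
(`ProjRes.nonempty_extSucc_iso`). -/

noncomputable section

/-! ### Realizing classes in Ext¹ by extensions -/

/-- The pushout of a short exact sequence `0 ⟶ K ⟶ Q ⟶ Z ⟶ 0` along `K ⟶ X` is a short exact
sequence `0 ⟶ X ⟶ Y ⟶ Z ⟶ 0` whose class is the image of the original one. -/
lemma CategoryTheory.ShortComplex.ShortExact.exists_pushout {C : Type*} [Category* C] [Abelian C]
    [HasExt.{v} C] {S : ShortComplex C} (hS : S.ShortExact) {X : C} (a : S.X₁ ⟶ X) :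
    ∃ (Y : C) (f : X ⟶ Y) (g : Y ⟶ S.X₃) (w : f ≫ g = 0)
      (h : (ShortComplex.mk f g w).ShortExact),
      h.extClass = hS.extClass.comp (Ext.mk₀ a) (add_zero 1) := by
  have := hS.mono_f
  have := hS.epi_g
  let f : X ⟶ pushout S.f a := pushout.inr _ _
  let g : pushout S.f a ⟶ S.X₃ := pushout.desc S.g 0 (by simp)
  have hg : pushout.inl S.f a ≫ g = S.g := pushout.inl_desc _ _ _
  have w : f ≫ g = 0 := pushout.inr_desc _ _ _
  have : Mono f := inferInstanceAs (Mono (pushout.inr S.f a))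
  have : Epi g := epi_of_epi_fac hg
  have hw {T : C} (k : pushout S.f a ⟶ T) (hk : f ≫ k = 0) :
      S.f ≫ pushout.inl S.f a ≫ k = 0 := by
    rw [pushout.condition_assoc]
    exact (congrArg (a ≫ ·) hk).trans comp_zero
  have hc : IsColimit (CokernelCofork.ofπ g w) := CokernelCofork.IsColimit.ofπ _ _
    (fun k hk => hS.exact.desc (pushout.inl S.f a ≫ k) (hw k hk))
    (fun k hk => by
      apply pushout.hom_ext
      · rw [reassoc_of% hg, hS.exact.g_desc]
      · change f ≫ g ≫ _ = _
        rw [reassoc_of% w, zero_comp]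
        exact hk.symm)
    (fun k hk m hm => by
      rw [← cancel_epi S.g, hS.exact.g_desc, ← hm, ← hg, Category.assoc])
  have h : (ShortComplex.mk f g w).ShortExact :=
    .mk' (ShortComplex.exact_of_g_is_cokernel _ hc) ‹_› ‹_›
  refine ⟨_, f, g, w, h, ?_⟩
  have := ShortComplex.ShortExact.extClass_naturality hS h
    { τ₁ := a, τ₂ := pushout.inl S.f a, τ₃ := 𝟙 _, comm₁₂ := pushout.condition.symm
      comm₂₃ := by simpa using! hg }
  rw [this]
  simp

variable {A : Type u} [Ring A]

/-- Every class in `Ext¹(Z, X)` is the class of an extension. -/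
lemma ModuleCat.exists_shortExact_extClass_eq {Z X : ModuleCat.{u} A} (ζ : Ext Z X 1) :
    ∃ (Y : ModuleCat.{u} A) (f : X ⟶ Y) (g : Y ⟶ Z) (w : f ≫ g = 0)
      (h : (ShortComplex.mk f g w).ShortExact), h.extClass = ζ := by
  -- The presentation lives in all modules: its terms need not be finitely generated, but every
  -- class in Ext¹ is a pushout of its class.
  have hS : (ShortComplex.mk (kernel.ι (Projective.π Z)) (Projective.π Z)
      (kernel.condition _)).ShortExact :=
    .mk' (ShortComplex.exact_kernel _) inferInstance inferInstance
  obtain ⟨a, ha⟩ := Ext.contravariant_sequence_exact₃ hS X ζ (Ext.eq_zero_of_projective _)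
    (add_zero 1)
  obtain ⟨Y, f, g, w, h, e⟩ := hS.exists_pushout (Ext.homEquiv₀ a)
  exact ⟨Y, f, g, w, h, by rw [e, Ext.mk₀_homEquiv₀_apply]; exact ha⟩

/-! ### Calculus of pullbacks and pushouts in Ext¹ -/

namespace FGModuleCat

variable {M M' M'' X X' X'' : FGModuleCat.{u} A}

/-- The pullback of a class in `Ext¹` along a homomorphism. -/
def extPull (g : M' ⟶ M) (η : Ext M.obj X.obj 1) : Ext M'.obj X.obj 1 :=
  (Ext.mk₀ g.hom).comp η (zero_add 1)

/-- The pushout of a class in `Ext¹` along a homomorphism. -/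
def extPush (f : X ⟶ X') (η : Ext M.obj X.obj 1) : Ext M.obj X'.obj 1 :=
  η.comp (Ext.mk₀ f.hom) (add_zero 1)

@[simp] lemma extPull_id (η : Ext M.obj X.obj 1) : extPull (𝟙 M) η = η :=
  Ext.mk₀_id_comp η

@[simp] lemma extPush_id (η : Ext M.obj X.obj 1) : extPush (𝟙 X) η = η :=
  Ext.comp_mk₀_id η

lemma extPull_comp (g' : M'' ⟶ M') (g : M' ⟶ M) (η : Ext M.obj X.obj 1) :
    extPull (g' ≫ g) η = extPull g' (extPull g η) :=
  (Ext.mk₀_comp_mk₀_assoc g'.hom g.hom η).symm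

lemma extPush_comp (f : X ⟶ X') (f' : X' ⟶ X'') (η : Ext M.obj X.obj 1) :
    extPush (f ≫ f') η = extPush f' (extPush f η) := by
  unfold extPush
  rw [Ext.comp_assoc_of_third_deg_zero, Ext.mk₀_comp_mk₀]
  rfl

lemma extPull_extPush (g : M' ⟶ M) (f : X ⟶ X') (η : Ext M.obj X.obj 1) :
    extPull g (extPush f η) = extPush f (extPull g η) :=
  (Ext.comp_assoc_of_third_deg_zero _ _ _ _).symm

@[simp] lemma extPull_zero (g : M' ⟶ M) : extPull g (0 : Ext M.obj X.obj 1) = 0 :=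
  Ext.comp_zero _ _ _ _ _

@[simp] lemma extPush_zero (f : X ⟶ X') : extPush f (0 : Ext M.obj X.obj 1) = 0 :=
  Ext.zero_comp _ _ _ _ _

lemma extPull_add (g : M' ⟶ M) (η θ : Ext M.obj X.obj 1) :
    extPull g (η + θ) = extPull g η + extPull g θ := Ext.comp_add _ _ _ _

lemma add_extPull (g h : M' ⟶ M) (η : Ext M.obj X.obj 1) :
    extPull (g + h) η = extPull g η + extPull h η := by
  unfold extPull
  rw [← Ext.add_comp, ← Ext.mk₀_add]
  rfl

lemma neg_extPull (g : M' ⟶ M) (η : Ext M.obj X.obj 1) : extPull (-g) η = -extPull g η := by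
  unfold extPull
  rw [← Ext.neg_comp, ← Ext.mk₀_neg]
  rfl

lemma sub_extPull (g h : M' ⟶ M) (η : Ext M.obj X.obj 1) :
    extPull (g - h) η = extPull g η - extPull h η := by
  rw [sub_eq_add_neg, add_extPull, neg_extPull, ← sub_eq_add_neg]

lemma add_extPush (f g : X ⟶ X') (η : Ext M.obj X.obj 1) :
    extPush (f + g) η = extPush f η + extPush g η := by
  unfold extPush
  rw [← Ext.comp_add, ← Ext.mk₀_add]
  rfl

/-- The product of two finitely generated modules. -/
abbrev prod (X Y : FGModuleCat.{u} A) : FGModuleCat.{u} A := of A (X × Y)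

/-- The first inclusion. -/
def inl (X Y : FGModuleCat.{u} A) : X ⟶ prod X Y := ofHom (LinearMap.inl A X Y)
/-- The second inclusion. -/
def inr (X Y : FGModuleCat.{u} A) : Y ⟶ prod X Y := ofHom (LinearMap.inr A X Y)
/-- The first projection. -/
def fst (X Y : FGModuleCat.{u} A) : prod X Y ⟶ X := ofHom (LinearMap.fst A X Y)
/-- The second projection. -/
def snd (X Y : FGModuleCat.{u} A) : prod X Y ⟶ Y := ofHom (LinearMap.snd A X Y)

lemma fst_inl_add_snd_inr (X Y : FGModuleCat.{u} A) :
    fst X Y ≫ inl X Y + snd X Y ≫ inr X Y = 𝟙 (prod X Y) := by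
  apply hom_ext
  apply LinearMap.ext
  rintro ⟨x, y⟩
  change (x, (0 : Y)) + ((0 : X), y) = (x, y)
  simp

end FGModuleCat

/-! ### `F`-exact sequences and their Hom–Ext¹ sequences -/

namespace ExtSubbifunctor

open FGModuleCat

variable (F : ExtSubbifunctor A)

/-- Finitely generated modules are closed under extensions, so that every class in `F(Z, X)` is the
class of an `F`-exact sequence. -/
lemma exists_isExact {Z X : FGModuleCat.{u} A} (ζ : Ext Z.obj X.obj 1) (hζ : ζ ∈ F.sub Z X) :
    ∃ (Y : FGModuleCat.{u} A) (f : X ⟶ Y) (g : Y ⟶ Z) (w : f.hom ≫ g.hom = 0)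
      (h : (ShortComplex.mk f.hom g.hom w).ShortExact), F.IsExact f g ∧ h.extClass = ζ := by
  obtain ⟨Y, f, g, w, h, rfl⟩ := ModuleCat.exists_shortExact_extClass_eq ζ
  have hY : Module.Finite A Y := Module.Finite.of_exact (f := f.hom) (g := g.hom)
    ((ShortComplex.ShortExact.moduleCat_exact_iff_function_exact _).mp h.exact)
    h.moduleCat_surjective_g
  let Y' : FGModuleCat.{u} A := ⟨Y, hY⟩
  let f' : X ⟶ Y' := ⟨f⟩
  let g' : Y' ⟶ Z := ⟨g⟩
  exact ⟨Y', f', g', w, h, ⟨w, h, hζ⟩, rfl⟩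

namespace IsExact

variable {F} {X Y Z W : FGModuleCat.{u} A} {f : X ⟶ Y} {g : Y ⟶ Z} (h : F.IsExact f g)

/-- The class of an `F`-exact sequence. -/
def extClass : Ext Z.obj X.obj 1 := h.choose_spec.choose.extClass

include h in
lemma comp_eq_zero : f ≫ g = 0 := ObjectProperty.hom_ext _ h.choose

lemma extClass_mem : h.extClass ∈ F.sub Z X := h.choose_spec.choose_spec

include h in
lemma injective : Function.Injective f.hom.hom := h.choose_spec.choose.moduleCat_injective_f

include h in
lemma surjective : Function.Surjective g.hom.hom := h.choose_spec.choose.moduleCat_surjective_g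

include h in
lemma mono : Mono f where
  right_cancellation a b e := by
    apply FGModuleCat.hom_ext
    apply LinearMap.ext
    intro x
    exact h.injective (LinearMap.congr_fun (congrArg (fun k => k.hom.hom) e) x)

include h in
lemma epi : Epi g where
  left_cancellation a b e := by
    apply FGModuleCat.hom_ext
    apply LinearMap.ext
    intro z
    obtain ⟨y, rfl⟩ := h.surjective z
    exact LinearMap.congr_fun (congrArg (fun k => k.hom.hom) e) y

include h in
lemma exists_lift (k : W ⟶ Y) (hk : k ≫ g = 0) : ∃ l : W ⟶ X, l ≫ f = k := by
  have := h.choose_spec.choose.mono_f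
  obtain ⟨l, hl⟩ := h.choose_spec.choose.exact.lift' k.hom (congrArg (·.hom) hk)
  exact ⟨⟨l⟩, ObjectProperty.hom_ext _ hl⟩

include h in
lemma exists_desc (k : Y ⟶ W) (hk : f ≫ k = 0) : ∃ l : Z ⟶ W, g ≫ l = k := by
  have := h.choose_spec.choose.epi_g
  obtain ⟨l, hl⟩ := h.choose_spec.choose.exact.desc' k.hom (congrArg (·.hom) hk)
  exact ⟨⟨l⟩, ObjectProperty.hom_ext _ hl⟩

@[simp] lemma extPull_extClass : extPull g h.extClass = 0 :=
  h.choose_spec.choose.comp_extClass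

@[simp] lemma extPush_extClass : extPush f h.extClass = 0 :=
  h.choose_spec.choose.extClass_comp

/-- This and the next three lemmas are exactness of the two long Hom–Ext¹ sequences on either side
of the connecting maps, in terms of elements. -/
lemma exists_comp_eq (k : W ⟶ Z) (hk : extPull k h.extClass = 0) : ∃ l : W ⟶ Y, l ≫ g = k := by
  obtain ⟨x, hx⟩ := Ext.covariant_sequence_exact₃ W.obj h.choose_spec.choose (Ext.mk₀ k.hom)
    (zero_add 1) hk
  obtain ⟨l, rfl⟩ := (Ext.mk₀_bijective _ _).2 x
  exact ⟨⟨l⟩, ObjectProperty.hom_ext _ ((Ext.mk₀_bijective _ _).1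
    ((Ext.mk₀_comp_mk₀ _ _).symm.trans hx))⟩

lemma exists_eq_comp (k : X ⟶ W) (hk : extPush k h.extClass = 0) : ∃ l : Y ⟶ W, f ≫ l = k := by
  obtain ⟨x, hx⟩ := Ext.contravariant_sequence_exact₁ h.choose_spec.choose W.obj (Ext.mk₀ k.hom)
    (add_zero 1) hk
  obtain ⟨l, rfl⟩ := (Ext.mk₀_bijective _ _).2 x
  exact ⟨⟨l⟩, ObjectProperty.hom_ext _ ((Ext.mk₀_bijective _ _).1
    ((Ext.mk₀_comp_mk₀ _ _).symm.trans hx))⟩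

lemma exists_extPush_eq (ζ : Ext Z.obj W.obj 1) (hζ : extPull g ζ = 0) :
    ∃ k : X ⟶ W, extPush k h.extClass = ζ := by
  obtain ⟨x, hx⟩ := Ext.contravariant_sequence_exact₃ h.choose_spec.choose W.obj ζ hζ (add_zero 1)
  obtain ⟨k, rfl⟩ := (Ext.mk₀_bijective _ _).2 x
  exact ⟨⟨k⟩, hx⟩

lemma exists_extPull_eq (ζ : Ext W.obj X.obj 1) (hζ : extPush f ζ = 0) :
    ∃ k : W ⟶ Z, extPull k h.extClass = ζ := by
  obtain ⟨x, hx⟩ := Ext.covariant_sequence_exact₁ W.obj h.choose_spec.choose ζ hζ (zero_add 1)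
  obtain ⟨k, rfl⟩ := (Ext.mk₀_bijective _ _).2 x
  exact ⟨⟨k⟩, hx⟩

end IsExact

end ExtSubbifunctor

/-! ### Null homomorphisms and stable isomorphism -/

namespace ExtSubbifunctor

open FGModuleCat

variable (F : ExtSubbifunctor A)

variable {M M' M'' N L L' P P' : FGModuleCat.{u} A}

/-- A homomorphism `f : M ⟶ N` that induces the zero map `Ext¹_F(N, -) ⟶ Ext¹_F(M, -)`. -/
def IsNull (f : M ⟶ N) : Prop :=
  ∀ (X : FGModuleCat.{u} A) (ζ : Ext N.obj X.obj 1), ζ ∈ F.sub N X → extPull f ζ = 0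

variable {F}

lemma extPush_mem {X X' : FGModuleCat.{u} A} (f : X ⟶ X') {η : Ext M.obj X.obj 1}
    (hη : η ∈ F.sub M X) : extPush f η ∈ F.sub M X' := F.pushout_mem f η hη

lemma extPull_mem {X : FGModuleCat.{u} A} (g : M' ⟶ M) {η : Ext M.obj X.obj 1}
    (hη : η ∈ F.sub M X) : extPull g η ∈ F.sub M' X := F.pullback_mem g η hη

lemma IsNull.add {f g : M ⟶ N} (hf : F.IsNull f) (hg : F.IsNull g) : F.IsNull (f + g) :=
  fun X ζ hζ => by rw [add_extPull, hf X ζ hζ, hg X ζ hζ, add_zero]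

lemma IsNull.neg {f : M ⟶ N} (hf : F.IsNull f) : F.IsNull (-f) :=
  fun X ζ hζ => by rw [neg_extPull, hf X ζ hζ, neg_zero]

lemma IsNull.comp_left {g : M' ⟶ N} (hg : F.IsNull g) (f : M ⟶ M') : F.IsNull (f ≫ g) :=
  fun X ζ hζ => by rw [extPull_comp, hg X ζ hζ, extPull_zero]

lemma IsNull.comp_right {f : M ⟶ M'} (hf : F.IsNull f) (g : M' ⟶ N) : F.IsNull (f ≫ g) :=
  fun X ζ hζ => by rw [extPull_comp, hf X _ (extPull_mem g hζ)]

/-- A class in `F(P, X)` is realized by an `F`-exact sequence, which splits when `𝟙 P` lifts.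
Conversely, if `𝟙 P` is null, the obstruction to lifting any map out of `P` vanishes. -/
lemma isProjective_iff_isNull_id : F.IsProjective P ↔ F.IsNull (𝟙 P) := by
  constructor
  · intro hP X ζ hζ
    obtain ⟨Y, f, g, w, h, hfg, rfl⟩ := F.exists_isExact ζ hζ
    obtain ⟨k, hk⟩ := hP f g hfg (𝟙 P)
    rw [← hk, extPull_comp]
    exact (congrArg _ h.comp_extClass).trans (extPull_zero k)
  · intro hP X Y Z f g h k
    refine h.exists_comp_eq k ?_
    rw [← Category.id_comp k]
    exact hP.comp_right k X _ h.extClass_mem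

lemma IsProjective.isNull_comp (hP : F.IsProjective P) (f : M ⟶ P) (g : P ⟶ N) :
    F.IsNull (f ≫ g) := by
  rw [← Category.id_comp g]
  exact ((isProjective_iff_isNull_id.1 hP).comp_right g).comp_left f

lemma IsProjective.extPull_eq_zero (hP : F.IsProjective P) (f : P ⟶ N) {X : FGModuleCat.{u} A}
    {ζ : Ext N.obj X.obj 1} (hζ : ζ ∈ F.sub N X) : extPull f ζ = 0 := by
  simpa using hP.isNull_comp (𝟙 P) f X ζ hζ

/-- The obstruction to lifting `f` is the pullback of a class in `F`. For `P` `F`-projective this is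
the converse of `IsProjective.isNull_comp`. -/
lemma IsExact.exists_comp_eq_of_isNull {i : L ⟶ P} {p : P ⟶ N} (h : F.IsExact i p) {f : M ⟶ N}
    (hf : F.IsNull f) : ∃ s : M ⟶ P, s ≫ p = f :=
  h.exists_comp_eq f (hf _ _ h.extClass_mem)

lemma IsProjective.prod (hP : F.IsProjective P) (hP' : F.IsProjective P') :
    F.IsProjective (FGModuleCat.prod P P') := by
  rw [isProjective_iff_isNull_id, ← fst_inl_add_snd_inr]
  exact (hP.isNull_comp _ _).add (hP'.isNull_comp _ _)

variable (F) in
/-- `M` and `N` are isomorphic modulo homomorphisms that are null on `Ext¹_F`. -/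
def StablyIso (M N : FGModuleCat.{u} A) : Prop :=
  ∃ (k : M ⟶ N) (h : N ⟶ M), F.IsNull (k ≫ h - 𝟙 M) ∧ F.IsNull (h ≫ k - 𝟙 N)

lemma isNull_zero : F.IsNull (0 : M ⟶ N) := fun X ζ _ => by
  have := add_extPull (0 : M ⟶ N) 0 ζ
  simpa using this

lemma StablyIso.of_iso (e : M ≅ N) : F.StablyIso M N :=
  ⟨e.hom, e.inv, by simpa using isNull_zero, by simpa using isNull_zero⟩

lemma StablyIso.of_linearEquiv (e : M ≃ₗ[A] N) : F.StablyIso M N :=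
  .of_iso (M := .of A M) (N := .of A N) e.toFGModuleCatIso

/-! ### The functors `Ext¹_F(M, -)` and their natural transformations -/

variable (F) in
/-- The natural transformation `Ext¹_F(N, -) ⟶ Ext¹_F(M, -)` induced by `M ⟶ N`. -/
def extOneMap (g : M ⟶ N) : F.extOne N ⟶ F.extOne M where
  app X := AddCommGrpCat.ofHom
    { toFun := fun η => ⟨extPull g η.1, extPull_mem g η.2⟩
      map_zero' := Subtype.ext (extPull_zero g)
      map_add' := fun a b => Subtype.ext (extPull_add g a.1 b.1) }
  naturality X X' f := by
    ext η
    exact Subtype.ext (extPull_extPush g f η.1)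

variable (F) in
/-- `Ext¹_F(-, -)` preserves isomorphisms in the first variable. -/
def extOneIso (e : M ≅ N) : F.extOne M ≅ F.extOne N where
  hom := F.extOneMap e.inv
  inv := F.extOneMap e.hom
  hom_inv_id := by
    ext X η
    refine Subtype.ext ((extPull_comp e.hom e.inv η.1).symm.trans ?_)
    rw [e.hom_inv_id]
    exact extPull_id η.1
  inv_hom_id := by
    ext X η
    refine Subtype.ext ((extPull_comp e.inv e.hom η.1).symm.trans ?_)
    rw [e.inv_hom_id]
    exact extPull_id η.1

lemma extOne_isZero (hP : F.IsProjective P) : IsZero (F.extOne P) := by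
  rw [Functor.isZero_iff]
  intro X
  have : Subsingleton ((F.extOne P).obj X) := ⟨fun a b => by
    have key (a : F.sub P X) : a.1 = 0 := by
      simpa using isProjective_iff_isNull_id.1 hP X a.1 a.2
    exact Subtype.ext ((key a).trans (key b).symm)⟩
  exact AddCommGrpCat.isZero_of_subsingleton _

/-- The class in `Ext¹(M, X)` underlying an element of `Ext¹_F(M, X)`. -/
def extOneVal {X : FGModuleCat.{u} A} (ζ : (F.extOne M).obj X) : Ext M.obj X.obj 1 :=
  ((show F.sub M X from ζ) : Ext M.obj X.obj 1)

lemma extOneVal_mem {X : FGModuleCat.{u} A} (ζ : (F.extOne M).obj X) :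
    extOneVal ζ ∈ F.sub M X := (show F.sub M X from ζ).2

/-- The element of `Ext¹_F(M, X)` given by a class in `F(M, X)`. -/
def extOneMk {X : FGModuleCat.{u} A} (ζ : Ext M.obj X.obj 1) (hζ : ζ ∈ F.sub M X) :
    (F.extOne M).obj X := (⟨ζ, hζ⟩ : F.sub M X)

@[simp] lemma extOneVal_extOneMk {X : FGModuleCat.{u} A} (ζ : Ext M.obj X.obj 1)
    (hζ : ζ ∈ F.sub M X) : extOneVal (extOneMk ζ hζ) = ζ := rfl

lemma extOneVal_injective {X : FGModuleCat.{u} A} {ζ ξ : (F.extOne M).obj X}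
    (h : extOneVal ζ = extOneVal ξ) : ζ = ξ := Subtype.ext h

lemma extOneVal_zero {X : FGModuleCat.{u} A} : extOneVal (0 : (F.extOne M).obj X) = 0 := rfl

lemma extOneVal_map {X X' : FGModuleCat.{u} A} (f : X ⟶ X') (ζ : (F.extOne M).obj X) :
    extOneVal ((F.extOne M).map f ζ) = extPush f (extOneVal ζ) := rfl

/-- Every natural transformation `Ext¹_F(M, -) ⟶ Ext¹_F(N, -)` is induced by a homomorphism
`N ⟶ M`. -/
lemma exists_extPull_eq_app (hF : F.EnoughProjectives) (φ : F.extOne M ⟶ F.extOne N) :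
    ∃ h : N ⟶ M, ∀ (X : FGModuleCat.{u} A) (ζ : (F.extOne M).obj X),
      extOneVal (φ.app X ζ) = extPull h (extOneVal ζ) := by
  obtain ⟨L, P, i, p, hP, hip⟩ := hF M
  have nat {X X' : FGModuleCat.{u} A} (f : X ⟶ X') (ζ : (F.extOne M).obj X) :
      extOneVal (φ.app X' ((F.extOne M).map f ζ)) = extPush f (extOneVal (φ.app X ζ)) := by
    rw [← extOneVal_map]
    exact congrArg extOneVal (ConcreteCategory.congr_hom (φ.naturality f) ζ)
  -- The universal class: it plays the role of the identity in the Yoneda lemma. Its image under `φ`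
  -- is killed by `i`, hence is a pullback of `η` along some `h`.
  let η : (F.extOne M).obj L := extOneMk hip.extClass hip.extClass_mem
  have hη : (F.extOne M).map i η = 0 := extOneVal_injective hip.extPush_extClass
  obtain ⟨h, hh⟩ := hip.exists_extPull_eq (extOneVal (φ.app L η)) (by
    rw [← nat, hη, map_zero, extOneVal_zero])
  refine ⟨h, fun X ζ => ?_⟩
  -- Every `ζ` dies on the `F`-projective `P`, so it is a pushout of `η`, and naturality determines
  -- `φ` on it.
  obtain ⟨f, hf⟩ := hip.exists_extPush_eq (extOneVal ζ) (hP.extPull_eq_zero p (extOneVal_mem ζ))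
  have hζ : ζ = (F.extOne M).map f η := extOneVal_injective hf.symm
  rw [hζ, nat, ← hh, extOneVal_map, extPull_extPush]
  rfl

/-- Modules with isomorphic functors `Ext¹_F(-, ?)` are stably isomorphic. -/
lemma StablyIso.of_extOne_iso (hF : F.EnoughProjectives) (φ : F.extOne M ≅ F.extOne N) :
    F.StablyIso M N := by
  obtain ⟨h, hh⟩ := exists_extPull_eq_app hF φ.hom
  obtain ⟨k, hk⟩ := exists_extPull_eq_app hF φ.inv
  refine ⟨k, h, fun X ζ hζ => ?_, fun X ζ hζ => ?_⟩
  · have e : φ.inv.app X (φ.hom.app X (extOneMk ζ hζ)) = extOneMk ζ hζ :=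
      ConcreteCategory.congr_hom (φ.hom_inv_id_app X) _
    rw [sub_extPull, extPull_comp, extPull_id, sub_eq_zero, ← extOneVal_extOneMk ζ hζ, ← hh, ← hk,
      e]
  · have e : φ.hom.app X (φ.inv.app X (extOneMk ζ hζ)) = extOneMk ζ hζ :=
      ConcreteCategory.congr_hom (φ.inv_hom_id_app X) _
    rw [sub_extPull, extPull_comp, extPull_id, sub_eq_zero, ← extOneVal_extOneMk ζ hζ, ← hk, ← hh,
      e]

/-! ### Relative syzygies under stable isomorphism and direct sums -/

/-- A homotopy argument: lift `c - 𝟙 M` to `s : M ⟶ P`; then `b - 𝟙 P - p ≫ s` lands in `L`, and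
restricting it to `L` shows that `a - 𝟙 L` factors through `P`. -/
lemma isNull_syzygy_map {i : L ⟶ P} {p : P ⟶ M} (hP : F.IsProjective P) (hip : F.IsExact i p)
    {c : M ⟶ M} {b : P ⟶ P} {a : L ⟶ L} (hc : F.IsNull (c - 𝟙 M)) (hb : b ≫ p = p ≫ c)
    (ha : a ≫ i = i ≫ b) : F.IsNull (a - 𝟙 L) := by
  obtain ⟨s, hs⟩ := hip.exists_comp_eq_of_isNull hc
  obtain ⟨t, ht⟩ := hip.exists_lift (b - 𝟙 P - p ≫ s) (by simp [hs, hb])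
  have := hip.mono
  have e : a - 𝟙 L = i ≫ t := by
    rw [← cancel_mono i, Category.assoc, ht]
    simp [ha, reassoc_of% hip.comp_eq_zero]
  rw [e]
  exact hP.isNull_comp i t

/-- Relative syzygies of stably isomorphic modules are stably isomorphic. -/
lemma StablyIso.syzygy (hMN : F.StablyIso M N) (hL : F.IsSyzygy M L) (hL' : F.IsSyzygy N L') :
    F.StablyIso L L' := by
  obtain ⟨k, h, hkh, hhk⟩ := hMN
  obtain ⟨P, i, p, hP, hip⟩ := hL
  obtain ⟨P', i', p', hP', hip'⟩ := hL'
  obtain ⟨k₀, hk₀⟩ := hP i' p' hip' (p ≫ k)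
  obtain ⟨h₀, hh₀⟩ := hP' i p hip (p' ≫ h)
  obtain ⟨k₁, hk₁⟩ := hip'.exists_lift (i ≫ k₀) (by
    simp [hk₀, reassoc_of% hip.comp_eq_zero])
  obtain ⟨h₁, hh₁⟩ := hip.exists_lift (i' ≫ h₀) (by
    simp [hh₀, reassoc_of% hip'.comp_eq_zero])
  refine ⟨k₁, h₁, isNull_syzygy_map (b := k₀ ≫ h₀) hP hip hkh ?_ ?_,
    isNull_syzygy_map (b := h₀ ≫ k₀) hP' hip' hhk ?_ ?_⟩
  · rw [Category.assoc, hh₀, reassoc_of% hk₀]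
  · rw [Category.assoc, hh₁, reassoc_of% hk₁]
  · rw [Category.assoc, hk₀, reassoc_of% hh₀]
  · rw [Category.assoc, hk₁, reassoc_of% hh₁]

/-- A relative syzygy of an `F`-projective module is `F`-projective. -/
lemma IsSyzygy.isProjective (hL : F.IsSyzygy M L) (hM : F.IsProjective M) : F.IsProjective L := by
  obtain ⟨P, i, p, hP, hip⟩ := hL
  -- Since `𝟙 M` is null, the zero endomorphism of the sequence qualifies, and the conclusion is
  -- that `-𝟙 L` is null.
  have := isNull_syzygy_map (c := 0) (b := 0) (a := 0) hP hip
    (by simpa using (isProjective_iff_isNull_id.1 hM).neg) (by simp) (by simp)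
  rw [isProjective_iff_isNull_id]
  simpa using this.neg

/-- Membership in `F` holds because the class of the product is the sum of the two given classes,
each pulled back along a projection and pushed out along an inclusion. -/
lemma IsExact.prod {X Y Z X' Y' Z' : FGModuleCat.{u} A} {f : X ⟶ Y} {g : Y ⟶ Z} {f' : X' ⟶ Y'}
    {g' : Y' ⟶ Z'} (h : F.IsExact f g) (h' : F.IsExact f' g') :
    F.IsExact (ofHom (f.hom.hom.prodMap f'.hom.hom) : FGModuleCat.prod X X' ⟶ FGModuleCat.prod Y Y')
      (ofHom (g.hom.hom.prodMap g'.hom.hom) : FGModuleCat.prod Y Y' ⟶ FGModuleCat.prod Z Z') := by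
  obtain ⟨w, s, m⟩ := h
  obtain ⟨w', s', m'⟩ := h'
  have e := (ShortComplex.ShortExact.moduleCat_exact_iff_function_exact _).mp s.exact
  have e' := (ShortComplex.ShortExact.moduleCat_exact_iff_function_exact _).mp s'.exact
  let F₁ : FGModuleCat.prod X X' ⟶ FGModuleCat.prod Y Y' := ofHom (f.hom.hom.prodMap f'.hom.hom)
  let G₁ : FGModuleCat.prod Y Y' ⟶ FGModuleCat.prod Z Z' := ofHom (g.hom.hom.prodMap g'.hom.hom)
  have eF : Function.Exact F₁.hom.hom G₁.hom.hom := by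
    rintro ⟨y, y'⟩
    constructor
    · intro hy
      obtain ⟨x, hx⟩ := (e y).1 (congrArg Prod.fst hy)
      obtain ⟨x', hx'⟩ := (e' y').1 (congrArg Prod.snd hy)
      exact ⟨(x, x'), Prod.ext hx hx'⟩
    · rintro ⟨⟨x, x'⟩, hx⟩
      exact Prod.ext ((e y).2 ⟨x, congrArg Prod.fst hx⟩) ((e' y').2 ⟨x', congrArg Prod.snd hx⟩)
  have w₁ : F₁.hom ≫ G₁.hom = 0 := by
    apply ModuleCat.hom_ext
    apply LinearMap.ext
    exact fun x => (eF _).2 ⟨x, rfl⟩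
  have s₁ : (ShortComplex.mk F₁.hom G₁.hom w₁).ShortExact :=
    ModuleCat.shortComplex_shortExact _ eF
      (Function.Injective.prodMap s.moduleCat_injective_f s'.moduleCat_injective_f)
      (Function.Surjective.prodMap s.moduleCat_surjective_g s'.moduleCat_surjective_g)
  refine ⟨w₁, s₁, ?_⟩
  have n : extPush (fst X X') s₁.extClass = extPull (fst Z Z') s.extClass :=
    ShortComplex.ShortExact.extClass_naturality s₁ s
      { τ₁ := (fst X X').hom, τ₂ := (fst Y Y').hom, τ₃ := (fst Z Z').hom }
  have n' : extPush (snd X X') s₁.extClass = extPull (snd Z Z') s'.extClass :=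
    ShortComplex.ShortExact.extClass_naturality s₁ s'
      { τ₁ := (snd X X').hom, τ₂ := (snd Y Y').hom, τ₃ := (snd Z Z').hom }
  have d := extPush_id (M := FGModuleCat.prod Z Z') (X := FGModuleCat.prod X X') s₁.extClass
  rw [← fst_inl_add_snd_inr, add_extPush, extPush_comp, extPush_comp, n, n'] at d
  rw [← d]
  exact add_mem (extPush_mem _ (extPull_mem _ m)) (extPush_mem _ (extPull_mem _ m'))

lemma IsSyzygy.prod (hL : F.IsSyzygy M L) (hL' : F.IsSyzygy M' L') :
    F.IsSyzygy (FGModuleCat.prod M M') (FGModuleCat.prod L L') := by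
  obtain ⟨P, i, p, hP, hip⟩ := hL
  obtain ⟨P', i', p', hP', hip'⟩ := hL'
  exact ⟨FGModuleCat.prod P P', _, _, hP.prod hP', hip.prod hip'⟩

/-! ### Stable isomorphism and classes in `K_F(A)` -/

lemma kMk_eq_add {N X Y : FGModuleCat.{u} A} (e : N ≃ₗ[A] X × Y) :
    F.kMk N = F.kMk X + F.kMk Y := by
  rw [← sub_eq_zero, ← sub_sub]
  exact (QuotientAddGroup.eq_zero_iff _).2 (AddSubgroup.subset_closure (.inl ⟨N, X, Y, ⟨e⟩, rfl⟩))

lemma kMk_eq_zero (hP : F.IsProjective P) : F.kMk P = 0 :=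
  (QuotientAddGroup.eq_zero_iff _).2 (AddSubgroup.subset_closure (.inr ⟨P, hP, rfl⟩))

/-- A split epimorphism `r` induces a decomposition of its domain. -/
def splitEquiv {V W : Type*} [AddCommGroup V] [Module A V] [AddCommGroup W] [Module A W]
    (r : V →ₗ[A] W) (s : W →ₗ[A] V) (h : ∀ w, r (s w) = w) : V ≃ₗ[A] W × LinearMap.ker r where
  toFun v := (r v, ⟨v - s (r v), by simp [h]⟩)
  invFun x := s x.1 + x.2.1
  map_add' x y := by
    ext
    · simp
    · simp; abel
  map_smul' a x := by ext <;> simp [smul_sub]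
  left_inv x := by simp
  right_inv x := by
    obtain ⟨m, q, hq⟩ := x
    have : r q = 0 := hq
    ext <;> simp [h, this]

/-- Stably isomorphic modules have the same class in `K_F(A)`. -/
lemma StablyIso.kMk_eq (hF : F.EnoughProjectives) (hMN : F.StablyIso M N) :
    F.kMk M = F.kMk N := by
  obtain ⟨k, h, hkh, hhk⟩ := hMN
  obtain ⟨L, P, i, b, hP, hib⟩ := hF M
  obtain ⟨a, ha⟩ := hib.exists_comp_eq_of_isNull hkh
  -- From `k ≫ h - 𝟙 M = a ≫ b`, the map `(k, -a)` is a section of `(h, b)`, so `N ⊕ P ≅ M ⊕ Q` with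
  -- `Q` the kernel of `r`.
  let s : M ⟶ FGModuleCat.prod N P := k ≫ inl N P - a ≫ inr N P
  let r : FGModuleCat.prod N P ⟶ M := fst N P ≫ h + snd N P ≫ b
  have inlfst : inl N P ≫ fst N P = 𝟙 _ := rfl
  have inlsnd : inl N P ≫ snd N P = 0 := rfl
  have inrfst : inr N P ≫ fst N P = 0 := rfl
  have inrsnd : inr N P ≫ snd N P = 𝟙 _ := rfl
  have hsr : s ≫ r = 𝟙 M := by
    simp only [s, r, Preadditive.comp_add, Preadditive.sub_comp, Category.assoc,
      reassoc_of% inlfst, reassoc_of% inlsnd, reassoc_of% inrfst, reassoc_of% inrsnd, zero_comp,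
      comp_zero, ha]
    abel
  have hsr' (x : M) : r.hom.hom (s.hom.hom x) = x :=
    LinearMap.congr_fun (congrArg (fun k => k.hom.hom) hsr) x
  let E : FGModuleCat.prod N P ≃ₗ[A] M × LinearMap.ker r.hom.hom :=
    splitEquiv r.hom.hom s.hom.hom hsr'
  have hfin : Module.Finite A (LinearMap.ker r.hom.hom) :=
    .of_surjective (LinearMap.snd A _ _ ∘ₗ E.toLinearMap)
      (Prod.snd_surjective.comp E.surjective)
  let Q : FGModuleCat.{u} A := .of A (LinearMap.ker r.hom.hom)
  let j : Q ⟶ FGModuleCat.prod N P := ofHom (LinearMap.ker r.hom.hom).subtype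
  let q : FGModuleCat.prod N P ⟶ Q := ofHom (LinearMap.snd A _ _ ∘ₗ E.toLinearMap)
  have hjr : j ≫ r = 0 := by
    apply FGModuleCat.hom_ext
    apply LinearMap.ext
    exact fun x => x.2
  have hjq : j ≫ q = 𝟙 Q := by
    apply FGModuleCat.hom_ext
    apply LinearMap.ext
    intro x
    apply Subtype.ext
    change x.1 - s.hom.hom (r.hom.hom x.1) = x.1
    rw [show r.hom.hom x.1 = 0 from x.2]
    simp
  have hjh : j ≫ fst N P ≫ h = -((j ≫ snd N P) ≫ b) := by
    rw [eq_neg_iff_add_eq_zero, Category.assoc, ← Preadditive.comp_add]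
    exact hjr
  have hQ : F.IsProjective Q := by
    rw [isProjective_iff_isNull_id]
    -- On the `N`-component, replace the identity by `h ≫ k` minus the null map `h ≫ k - 𝟙 N`. Since
    -- `j ≫ r = 0`, the `h ≫ k` term factors through `P`, so all three summands are null.
    have e : 𝟙 Q = -(((j ≫ snd N P) ≫ b) ≫ k ≫ inl N P ≫ q) +
        -(((j ≫ fst N P) ≫ (h ≫ k - 𝟙 N)) ≫ inl N P ≫ q) + (j ≫ snd N P) ≫ inr N P ≫ q := by
      have e₁ : 𝟙 Q = j ≫ (fst N P ≫ inl N P + snd N P ≫ inr N P) ≫ q := by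
        rw [fst_inl_add_snd_inr, Category.id_comp, hjq]
      have e₂ := congrArg (· ≫ k ≫ inl N P ≫ q) hjh
      simp only [Category.assoc, Preadditive.neg_comp] at e₂
      rw [e₁]
      simp only [Preadditive.comp_add, Preadditive.add_comp, Preadditive.comp_sub,
        Preadditive.sub_comp, Category.assoc, Category.id_comp, ← e₂]
      abel
    rw [e]
    exact (((hP.isNull_comp _ _).comp_right _).neg.add ((hhk.comp_left _).comp_right _).neg).add
      (hP.isNull_comp _ _)
  have h₁ := kMk_eq_add (F := F) (N := FGModuleCat.prod N P) (X := M) (Y := Q) E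
  have h₂ := kMk_eq_add (F := F) (N := FGModuleCat.prod N P) (X := N) (Y := P) (.refl A _)
  rw [kMk_eq_zero hQ, add_zero] at h₁
  rw [kMk_eq_zero hP, add_zero] at h₂
  rw [← h₁, h₂]

end ExtSubbifunctor

/-! ### Homology of complexes of functors -/

/-- A short complex of functors is exact if it is so objectwise. -/
lemma CategoryTheory.ShortComplex.exact_of_evaluation {C D : Type*} [Category* C] [Category* D]
    [Abelian D] (S : ShortComplex (C ⥤ D))
    (h : ∀ X, (S.map ((evaluation C D).obj X)).Exact) : S.Exact := by
  rw [exact_iff_isZero_homology, Functor.isZero_iff]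
  intro X
  exact ((exact_iff_isZero_homology _).1 (h X)).of_iso
    (S.mapHomologyIso ((evaluation C D).obj X)).symm

/-- The homology of `S` is `H` if the cycles of `S` are `K` and `S.X₁ ⟶ K ⟶ H ⟶ 0` is exact. -/
def CategoryTheory.ShortComplex.homologyIsoOfExact {C : Type*} [Category* C] [Abelian C]
    (S : ShortComplex C) {K H : C} (i : K ⟶ S.X₂) (π : K ⟶ H) (f : S.X₁ ⟶ K) [Mono i] [Epi π]
    (hf : f ≫ i = S.f) (wi : i ≫ S.g = 0) (hi : (ShortComplex.mk i S.g wi).Exact)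
    (wπ : f ≫ π = 0) (hπ : (ShortComplex.mk f π wπ).Exact) : S.homology ≅ H :=
  have : Mono (ShortComplex.mk i S.g wi).f := ‹Mono i›
  have : Epi (ShortComplex.mk f π wπ).g := ‹Epi π›
  have hl : hi.fIsKernel.lift (KernelFork.ofι _ S.zero) = f := by
    rw [← cancel_mono i, hf]
    exact Fork.IsLimit.lift_ι hi.fIsKernel
  -- The homology data refer to the lift through the kernel, which equals `f` only propositionally;
  -- generalizing over `f'` transfers the cokernel property.
  have key : ∀ f' : S.X₁ ⟶ K, f' = f → ∃ w : f' ≫ π = 0,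
      Nonempty (IsColimit (CokernelCofork.ofπ π w)) := by
    rintro _ rfl
    exact ⟨wπ, ⟨hπ.gIsCokernel⟩⟩
  LeftHomologyData.homologyIso
    { K := K
      H := H
      i := i
      π := π
      wi := wi
      hi := hi.fIsKernel
      wπ := (key _ hl).choose
      hπ := (key _ hl).choose_spec.some }

/-! ### Cohomology of `F`-projective resolutions -/

namespace ExtSubbifunctor

open FGModuleCat

variable {F : ExtSubbifunctor A}

variable {M N L L' P P' : FGModuleCat.{u} A}

/-- The connecting homomorphism `Hom(L, -) ⟶ Ext¹_F(M, -)` of an `F`-exact sequence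
`0 ⟶ L ⟶ P ⟶ M ⟶ 0`. -/
def IsExact.connecting {i : L ⟶ P} {p : P ⟶ M} (h : F.IsExact i p) :
    preadditiveCoyoneda.obj (Opposite.op L) ⟶ F.extOne M where
  app X := AddCommGrpCat.ofHom
    { toFun := fun f => extOneMk (extPush (X := L) f h.extClass) (extPush_mem f h.extClass_mem)
      map_zero' := extOneVal_injective (by
        have := add_extPush (0 : L ⟶ X) 0 h.extClass
        rw [add_zero, left_eq_add] at this
        exact this)
      map_add' := fun f g => extOneVal_injective (add_extPush (X := L) f g h.extClass) }
  naturality X X' f := by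
    ext g
    exact extOneVal_injective (extPush_comp (X := L) g f h.extClass)

lemma ProjRes.isSyzygy (P : F.ProjRes M) (n : ℕ) : F.IsSyzygy (P.Z n) (P.Z (n + 1)) :=
  ⟨_, _, _, P.isProjective n, P.isExact n⟩

/-- The cohomology functor `Extⁿ⁺¹_F(M, -)` is `Ext¹_F(-, -)` of the `n`-th syzygy. -/
lemma ProjRes.nonempty_extSucc_iso (P : F.ProjRes M) (n : ℕ) :
    Nonempty (P.extSucc n ≅ F.extOne (P.Z n)) := by
  have h := P.isExact n
  have h₁ := P.isExact (n + 1)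
  have h₂ := P.isExact (n + 2)
  have : Epi (P.π (n + 1)) := h₁.epi
  have : Epi (P.π (n + 2)) := h₂.epi
  -- Cocycles in degree `n + 1` are the maps out of `Z (n + 1)`; coboundaries are those that extend
  -- over `P n`. The connecting map kills exactly the latter, and is onto because `P n` is
  -- `F`-projective.
  let i : preadditiveCoyoneda.obj (Opposite.op (P.Z (n + 1))) ⟶ (P.homComplex n).X₂ :=
    preadditiveCoyoneda.map (P.π (n + 1)).op
  let f : (P.homComplex n).X₁ ⟶ preadditiveCoyoneda.obj (Opposite.op (P.Z (n + 1))) :=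
    preadditiveCoyoneda.map (P.ι n).op
  have hf : f ≫ i = (P.homComplex n).f := (preadditiveCoyoneda.map_comp _ _).symm
  have wi : i ≫ (P.homComplex n).g = 0 := by
    change preadditiveCoyoneda.map _ ≫ preadditiveCoyoneda.map _ = 0
    rw [← Functor.map_comp, ← op_comp, ProjRes.d, Category.assoc, h₁.comp_eq_zero, comp_zero,
      op_zero, Functor.map_zero]
  have wπ : f ≫ h.connecting = 0 := by
    ext X (g : P.P n ⟶ X)
    refine extOneVal_injective ((extPush_comp (P.ι n) g h.extClass).trans ?_)
    rw [h.extPush_extClass, extPush_zero]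
    rfl
  have : Mono i := by
    have hX (X : FGModuleCat.{u} A) : Mono (i.app X) := by
      rw [AddCommGrpCat.mono_iff_injective]
      intro (a : P.Z (n + 1) ⟶ X) (b : P.Z (n + 1) ⟶ X) (e : P.π (n + 1) ≫ a = P.π (n + 1) ≫ b)
      exact (cancel_epi _).1 e
    exact NatTrans.mono_of_mono_app i
  have : Epi h.connecting := by
    have hX (X : FGModuleCat.{u} A) : Epi (h.connecting.app X) := by
      rw [AddCommGrpCat.epi_iff_surjective]
      intro ζ
      obtain ⟨k, hk⟩ := h.exists_extPush_eq (extOneVal ζ)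
        (IsProjective.extPull_eq_zero (P.isProjective n) _ (extOneVal_mem ζ))
      exact ⟨k, extOneVal_injective hk⟩
    exact NatTrans.epi_of_epi_app _
  refine ⟨(P.homComplex n).homologyIsoOfExact i h.connecting f hf wi ?_ wπ ?_⟩
  · refine ShortComplex.exact_of_evaluation _ fun X => ?_
    rw [ShortComplex.ab_exact_iff]
    intro (g : P.P (n + 1) ⟶ X) (hg : (P.π (n + 2) ≫ P.ι (n + 1)) ≫ g = 0)
    refine h₁.exists_desc g ?_
    rwa [Category.assoc, ← comp_zero, cancel_epi] at hg
  · refine ShortComplex.exact_of_evaluation _ fun X => ?_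
    rw [ShortComplex.ab_exact_iff]
    intro (g : P.Z (n + 1) ⟶ X) hg
    exact h.exists_eq_comp g (congrArg extOneVal hg)

lemma EnoughProjectives.nonempty_projRes (hF : F.EnoughProjectives) (M : FGModuleCat.{u} A) :
    Nonempty (F.ProjRes M) := by
  choose K P i p hP hip using hF
  let Z : ℕ → FGModuleCat.{u} A := fun n => K^[n] M
  have hZ (n : ℕ) : Z (n + 1) = K (Z n) := Function.iterate_succ_apply' K n M
  -- The iterate unfolds on the outside only up to a propositional equality, so `ι` is chosen after
  -- rewriting.
  have hip' (n : ℕ) : ∃ ι : Z (n + 1) ⟶ P (Z n), F.IsExact ι (p (Z n)) := by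
    rw [hZ]
    exact ⟨_, hip _⟩
  choose ι hι using hip'
  exact ⟨⟨fun n => P (Z n), Z, ι, fun n => p (Z n), Iso.refl M, fun n => hP _, hι⟩⟩

/-! ### The group `𝓔_F(A)` and the homomorphisms `ε` and `Ω_F` -/

variable (F) in
lemma extClasses_of_iso {H : FGModuleCat.{u} A ⥤ AddCommGrpCat.{u}} (e : H ≅ F.extOne M) :
    isoClass H ∈ F.extClasses := ⟨M, Quotient.sound ⟨e.symm⟩⟩

lemma eMk_eq {H H' : FGModuleCat.{u} A ⥤ AddCommGrpCat.{u}} (e : H ≅ H')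
    (h : isoClass H ∈ F.extClasses) (h' : isoClass H' ∈ F.extClasses) :
    F.eMk H h = F.eMk H' h' := by
  have : isoClass H = isoClass H' := Quotient.sound ⟨e⟩
  simp only [eMk, this]

/-- The generator `[Ext¹_F(M, -)]`. -/
abbrev eOne (F : ExtSubbifunctor A) (M : FGModuleCat.{u} A) : F.E :=
  F.eMk (F.extOne M) (F.extOne_mem M)

lemma eOne_eq_add {N X Y : FGModuleCat.{u} A} (e : N ≃ₗ[A] X × Y) :
    F.eOne N = F.eOne X + F.eOne Y := by
  rw [← sub_eq_zero, ← sub_sub]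
  exact (QuotientAddGroup.eq_zero_iff _).2 (AddSubgroup.subset_closure ⟨N, X, Y, ⟨e⟩, rfl⟩)

/-- No relation of `𝓔_F(A)` kills `F`-projectives directly, but `P` and `P ⊕ P` both give the zero
functor, so `[P] = [P] + [P]`. -/
lemma eOne_eq_zero (hP : F.IsProjective P) : F.eOne P = 0 := by
  have h : F.eOne (FGModuleCat.prod P P) = F.eOne P :=
    eMk_eq ((extOne_isZero (hP.prod hP)).iso (extOne_isZero hP)) _ _
  have h' := eOne_eq_add (F := F) (N := FGModuleCat.prod P P) (X := P) (Y := P) (.refl A _)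
  rwa [h, left_eq_add] at h'

/-- A function on modules that is invariant under isomorphism, additive and zero on `F`-projective
modules induces a homomorphism on `K_F(A)`. -/
def kLift {G : Type*} [AddCommGroup G] (φ : FGModuleCat.{u} A → G)
    (iso : ∀ M N : FGModuleCat.{u} A, (M ≅ N) → φ M = φ N)
    (add : ∀ N X Y : FGModuleCat.{u} A, (N ≃ₗ[A] X × Y) → φ N = φ X + φ Y)
    (zero : ∀ P : FGModuleCat.{u} A, F.IsProjective P → φ P = 0) : F.K →+ G :=
  QuotientAddGroup.lift _
    (FreeAbelianGroup.lift (Quotient.lift φ fun _ _ ⟨e⟩ => iso _ _ e)) (by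
      rw [AddSubgroup.closure_le]
      rintro _ (⟨N, X, Y, ⟨e⟩, rfl⟩ | ⟨P, hP, rfl⟩)
      · simp [AddMonoidHom.mem_ker, add _ _ _ e]
      · simp [AddMonoidHom.mem_ker, zero _ hP])

lemma kLift_kMk {G : Type*} [AddCommGroup G] (φ : FGModuleCat.{u} A → G)
    {iso : ∀ M N : FGModuleCat.{u} A, (M ≅ N) → φ M = φ N}
    {add : ∀ N X Y : FGModuleCat.{u} A, (N ≃ₗ[A] X × Y) → φ N = φ X + φ Y}
    {zero : ∀ P : FGModuleCat.{u} A, F.IsProjective P → φ P = 0} (M : FGModuleCat.{u} A) :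
    kLift (F := F) φ iso add zero (F.kMk M) = φ M :=
  FreeAbelianGroup.lift_apply_of _ _

/-- A function on modules that is invariant under isomorphism of the functors `Ext¹_F(M, -)` and
additive induces a homomorphism on `𝓔_F(A)`. -/
def eLift {G : Type*} [AddCommGroup G] (φ : FGModuleCat.{u} A → G)
    (iso : ∀ M N : FGModuleCat.{u} A, (F.extOne M ≅ F.extOne N) → φ M = φ N)
    (add : ∀ N X Y : FGModuleCat.{u} A, (N ≃ₗ[A] X × Y) → φ N = φ X + φ Y) : F.E →+ G :=
  -- A generator is a class of functors, so a module representing it must be chosen; invariance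
  -- under isomorphism of functors makes the choice irrelevant.
  have key (M : FGModuleCat.{u} A) :
      φ (F.extOne_mem M).choose = φ M := by
    obtain ⟨e⟩ := Quotient.exact (F.extOne_mem M).choose_spec
    exact iso _ _ e
  QuotientAddGroup.lift _
    (FreeAbelianGroup.lift fun H : F.extClasses => φ H.2.choose) (by
      rw [AddSubgroup.closure_le]
      rintro _ ⟨N, X, Y, ⟨e⟩, rfl⟩
      simp [AddMonoidHom.mem_ker, eGen, key, add _ _ _ e])

lemma eLift_eOne {G : Type*} [AddCommGroup G] (φ : FGModuleCat.{u} A → G)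
    {iso : ∀ M N : FGModuleCat.{u} A, (F.extOne M ≅ F.extOne N) → φ M = φ N}
    {add : ∀ N X Y : FGModuleCat.{u} A, (N ≃ₗ[A] X × Y) → φ N = φ X + φ Y}
    (M : FGModuleCat.{u} A) : eLift (F := F) φ iso add (F.eOne M) = φ M := by
  refine (FreeAbelianGroup.lift_apply_of _ _).trans ?_
  obtain ⟨e⟩ := Quotient.exact (F.extOne_mem M).choose_spec
  exact iso _ _ e

lemma kHom_ext {G : Type*} [AddCommGroup G] {f g : F.K →+ G}
    (h : ∀ M, f (F.kMk M) = g (F.kMk M)) : f = g := by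
  apply QuotientAddGroup.addMonoidHom_ext
  apply FreeAbelianGroup.lift_ext
  rintro ⟨M⟩
  exact h M

lemma eHom_ext {G : Type*} [AddCommGroup G] {f g : F.E →+ G}
    (h : ∀ M, f (F.eOne M) = g (F.eOne M)) : f = g := by
  apply QuotientAddGroup.addMonoidHom_ext
  apply FreeAbelianGroup.lift_ext
  rintro ⟨_, M, rfl⟩
  exact h M

/-- The isomorphism `ε : K_F(A) ≃ 𝓔_F(A)`, `[M] ↦ [Ext¹_F(M, -)]`. -/
def kEquivE (hF : F.EnoughProjectives) : F.K ≃+ F.E :=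
  AddMonoidHom.toAddEquiv
    (kLift F.eOne (fun _ _ e => eMk_eq (F.extOneIso e) _ _) (fun _ _ _ => eOne_eq_add)
      (fun _ => eOne_eq_zero))
    (eLift F.kMk (fun _ _ e => (StablyIso.of_extOne_iso hF e).kMk_eq hF) (fun _ _ _ => kMk_eq_add))
    (kHom_ext fun M => by simp [kLift_kMk, eLift_eOne])
    (eHom_ext fun M => by simp [kLift_kMk, eLift_eOne])

lemma kEquivE_kMk (hF : F.EnoughProjectives) (M : FGModuleCat.{u} A) :
    kEquivE hF (F.kMk M) = F.eOne M :=
  kLift_kMk F.eOne (iso := fun _ _ e => eMk_eq (F.extOneIso e) _ _)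
    (add := fun _ _ _ => eOne_eq_add) (zero := fun _ => eOne_eq_zero) M

lemma StablyIso.kMk_syzygy_eq (hF : F.EnoughProjectives) (h : F.StablyIso M N)
    (hL : F.IsSyzygy M L) (hL' : F.IsSyzygy N L') : F.kMk L = F.kMk L' :=
  (h.syzygy hL hL').kMk_eq hF

/-- The homomorphism `Ω_F : K_F(A) → K_F(A)`. -/
def kSyzygy (hF : F.EnoughProjectives) : F.K →+ F.K :=
  kLift (fun M => F.kMk (hF M).choose)
    (fun _ _ e => (StablyIso.of_iso e).kMk_syzygy_eq hF (hF _).choose_spec (hF _).choose_spec)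
    (fun N X Y e => by
      -- The sum of the chosen syzygies is a syzygy of the sum, though not the chosen one; the two
      -- agree in `K_F(A)`.
      rw [← kMk_eq_add (N := FGModuleCat.prod (hF X).choose (hF Y).choose) (.refl A _)]
      exact (StablyIso.of_linearEquiv (N := FGModuleCat.prod X Y) e).kMk_syzygy_eq hF
        (hF _).choose_spec ((hF X).choose_spec.prod (hF Y).choose_spec))
    (fun _ hP => kMk_eq_zero ((hF _).choose_spec.isProjective hP))

lemma kSyzygy_kMk (hF : F.EnoughProjectives) (hL : F.IsSyzygy M L) :
    kSyzygy hF (F.kMk M) = F.kMk L := by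
  rw [kSyzygy, kLift_kMk]
  exact (StablyIso.of_iso (Iso.refl M)).kMk_syzygy_eq hF (hF M).choose_spec hL

lemma ProjRes.kSyzygy_iterate (hF : F.EnoughProjectives) (P : F.ProjRes M) (n : ℕ) :
    (kSyzygy hF)^[n] (F.kMk M) = F.kMk (P.Z n) := by
  induction n with
  | zero => exact ((StablyIso.of_iso P.aug).kMk_eq hF).symm
  | succ n ih => rw [Function.iterate_succ_apply', ih, kSyzygy_kMk hF (P.isSyzygy n)]

end ExtSubbifunctor

end

/-! ### The theorem -/

open ExtSubbifunctor in
/-- `R` is a commutative artinian ring, `A` an artin `R`-algebra and `F` an additive subbifunctor of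
`Ext¹_A(-,-)` with enough projectives. The maps `ε`, `ΩK`, `ΩE` are determined by their prescribed
values on generators. -/
theorem theorem4p5 (R : Type v) [CommRing R] [IsArtinianRing R]
    {A : Type u} [Ring A] [Algebra R A] [Module.Finite R A]
    (F : ExtSubbifunctor A) (hF : F.EnoughProjectives) :
    ∃ (ε : F.K ≃+ F.E) (ΩK : F.K →+ F.K) (ΩE : F.E →+ F.E),
      (∀ M, ε (F.kMk M) = F.eMk (F.extOne M) (F.extOne_mem M)) ∧
      (∀ M L, F.IsSyzygy M L → ΩK (F.kMk M) = F.kMk L) ∧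
      (∀ M L, F.IsSyzygy M L →
        ΩE (F.eMk (F.extOne M) (F.extOne_mem M)) = F.eMk (F.extOne L) (F.extOne_mem L)) ∧
      (∀ x, ε (ΩK x) = ΩE (ε x)) ∧
      ∀ M, Nonempty (F.ProjRes M) ∧
        ∀ (P : F.ProjRes M) (n : ℕ), ∃ h : isoClass (P.extSucc n) ∈ F.extClasses,
          ε (ΩK^[n] (F.kMk M)) = F.eMk (P.extSucc n) h := by
  refine ⟨kEquivE hF, kSyzygy hF,
    -- `Ω_F` on `𝓔_F(A)` is the conjugate of `Ω_F` on `K_F(A)` by `ε`, so it commutes with `ε` by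
    -- construction and only its values on generators need checking.
    ((kEquivE hF).toAddMonoidHom.comp (kSyzygy hF)).comp (kEquivE hF).symm.toAddMonoidHom,
    kEquivE_kMk hF, fun M L => kSyzygy_kMk hF, fun M L hL => ?_, fun x => by simp,
    fun M => ⟨hF.nonempty_projRes M, fun P n => ?_⟩⟩
  · change kEquivE hF (kSyzygy hF ((kEquivE hF).symm (F.eOne M))) = F.eOne L
    rw [← kEquivE_kMk hF M, AddEquiv.symm_apply_apply, kSyzygy_kMk hF hL, kEquivE_kMk]
  · obtain ⟨e⟩ := P.nonempty_extSucc_iso n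
    refine ⟨extClasses_of_iso F e, ?_⟩
    rw [P.kSyzygy_iterate hF, kEquivE_kMk]
    exact eMk_eq e.symm _ _
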